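/- A pseudocomplemented distributive lattice is an algebra $(L,\vee,\wedge,0,1,{}^*)$ such that $(L,\vee,\wedge,0,1)$ is a bounded distributive lattice and, for all $x,y\in L$, $x\le y^*$ if and only if $x\wedge y=0$. For $n\in\mathbb N$ let $B_n^+=\mathbf 2^n\oplus\mathbf 1$ be the pseudocomplemented distributive lattice obtained by adding a new greatest element to the Boolean lattice $\mathbf 2^n$, and let $\mathcal B_n$ be the variety of pseudocomplemented distributive lattices generated by $B_n^+$. An algebra $B$ in a variety $\mathcal V$ is called congruence extensile in $\mathcal V$ if, for every algebra $C$ in $\mathcal V$ containing $B$ as a subalgebra and for every congruence $\Theta$ of $B$, there is a congruence $\Psi$ of $C$ such that $\Psi\cap(B\times B)=\Theta$. Corollary. Let $n\ge 2$ and let $I$ be any set. Then $\prod_{i\in I}B_n^+$ is congruence extensile in $\mathcal B_n$. -/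

import Mathlib

universe u v

/-- A pseudocomplemented distributive lattice `(L, ⊔, ⊓, ⊥, ⊤, ᶜ)`: a bounded distributive lattice
with a unary operation `ᶜ` such that `x ≤ yᶜ` if and only if `x ⊓ y = ⊥`. -/
class PDLattice (L : Type u) extends DistribLattice L, BoundedOrder L, Compl L where
  le_compl_iff : ∀ x y : L, x ≤ yᶜ ↔ x ⊓ y = ⊥

/-- Products of pseudocomplemented distributive lattices, with coordinatewise operations. -/
instance PDLattice.instPi {I : Type u} {L : I → Type v} [∀ i, PDLattice (L i)] :
    PDLattice (∀ i, L i) where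
  le_compl_iff x y := by
    constructor
    · intro h
      funext i
      exact (PDLattice.le_compl_iff (x i) (y i)).1 (h i)
    · intro h i
      exact (PDLattice.le_compl_iff (x i) (y i)).2 (congrFun h i)

/-- `*`-homomorphisms: maps preserving `⊔`, `⊓`, `⊥`, `⊤` and the pseudocomplement. -/
structure StarHom (L : Type u) (M : Type v) [PDLattice L] [PDLattice M] extends
    BoundedLatticeHom L M where
  map_compl' : ∀ x : L, toFun xᶜ = (toFun x)ᶜ

instance StarHom.instCoeFun {L : Type u} {M : Type v} [PDLattice L] [PDLattice M] :
    CoeFun (StarHom L M) (fun _ => L → M) where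
  coe f := f.toFun

/-- Congruences of a pseudocomplemented distributive lattice: equivalence relations compatible
with all the operations. -/
structure PDCongruence (L : Type u) [PDLattice L] extends Setoid L where
  sup' : ∀ {a b c d : L}, r a b → r c d → r (a ⊔ c) (b ⊔ d)
  inf' : ∀ {a b c d : L}, r a b → r c d → r (a ⊓ c) (b ⊓ d)
  compl' : ∀ {a b : L}, r a b → r aᶜ bᶜ

/-- Terms in the operations `∨, ∧, 0, 1, *` and the variables `x₀, x₁, …`. -/
inductive PDTerm : Type
  | var : ℕ → PDTerm
  | sup : PDTerm → PDTerm → PDTerm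
  | inf : PDTerm → PDTerm → PDTerm
  | bot : PDTerm
  | top : PDTerm
  | star : PDTerm → PDTerm

/-- The value of a term under an assignment of elements of `L` to the variables. -/
def PDTerm.eval {L : Type u} [PDLattice L] (a : ℕ → L) : PDTerm → L
  | .var k => a k
  | .sup s t => s.eval a ⊔ t.eval a
  | .inf s t => s.eval a ⊓ t.eval a
  | .bot => ⊥
  | .top => ⊤
  | .star t => (t.eval a)ᶜ

/-- An identity `s = t`. -/
abbrev PDIdentity : Type := PDTerm × PDTerm

/-- The identity `e` holds in `L`. -/
def PDIdentity.HoldsIn (e : PDIdentity) (L : Type u) [PDLattice L] : Prop :=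
  ∀ a : ℕ → L, e.1.eval a = e.2.eval a

/-- A subvariety of the variety of pseudocomplemented distributive lattices, presented by a set of
identities. Its members are the algebras in which all these identities hold. -/
structure PDVariety : Type where
  identities : Set PDIdentity

/-- `L` is a member of the variety `V`. -/
def PDVariety.Mem (V : PDVariety) (L : Type u) [PDLattice L] : Prop :=
  ∀ e ∈ V.identities, e.HoldsIn L

/-- The variety generated by `A`, i.e. the smallest variety having `A` as a member: it is the class
of models of all the identities that hold in `A`. -/
def PDVariety.generatedBy (A : Type u) [PDLattice A] : PDVariety where
  identities := {e | e.HoldsIn A}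

/-- `2ⁿ ⊕ 1`: the Boolean lattice `2ⁿ` with a new greatest element added. -/
def BPlus (n : ℕ) : Type := WithTop (Fin n → Bool)

namespace BPlus

instance instDistribLattice (n : ℕ) : DistribLattice (BPlus n) :=
  inferInstanceAs (DistribLattice (WithTop (Fin n → Bool)))

noncomputable instance instBoundedOrder (n : ℕ) : BoundedOrder (BPlus n) :=
  inferInstanceAs (BoundedOrder (WithTop (Fin n → Bool)))

/-- The inclusion of `2ⁿ` in `2ⁿ ⊕ 1`. -/
def of {n : ℕ} (b : Fin n → Bool) : BPlus n := WithTop.some b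

/-- The pseudocomplement in `2ⁿ ⊕ 1`: the new top goes to `⊥`, the element `⊥` goes to the new top,
and every other element of `2ⁿ` goes to its complement in `2ⁿ`. -/
noncomputable def star {n : ℕ} : BPlus n → BPlus n
  | none => ⊥
  | some b => if b = ⊥ then ⊤ else of bᶜ

theorem le_star_iff {n : ℕ} (x y : BPlus n) : x ≤ star y ↔ x ⊓ y = ⊥ := by
  have hcoe : ∀ b c : Fin n → Bool, (of b ⊓ of c = ⊥ ↔ b ⊓ c = ⊥) := fun b c =>
    WithTop.coe_inj (a := b ⊓ c) (b := ⊥)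
  have hbot : ∀ b : Fin n → Bool, (of b = ⊥ ↔ b = ⊥) := fun b =>
    WithTop.coe_inj (a := b) (b := ⊥)
  have htop : (⊤ : BPlus n) ≠ ⊥ := WithTop.top_ne_coe
  match x, y with
  | x, none =>
    change x ≤ ⊥ ↔ x ⊓ ⊤ = ⊥
    rw [le_bot_iff, inf_top_eq]
  | none, some c =>
    change ⊤ ≤ (if c = ⊥ then ⊤ else of cᶜ) ↔ ⊤ ⊓ of c = ⊥
    rw [top_inf_eq, hbot]
    by_cases hc : c = ⊥
    · simp [hc]
    · rw [if_neg hc]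
      exact iff_of_false (WithTop.not_top_le_coe cᶜ) hc
  | some b, some c =>
    change of b ≤ (if c = ⊥ then ⊤ else of cᶜ) ↔ of b ⊓ of c = ⊥
    rw [hcoe]
    by_cases hc : c = ⊥
    · simp [hc]
    · rw [if_neg hc, ← disjoint_iff, ← le_compl_iff_disjoint_right]
      exact WithTop.coe_le_coe

noncomputable instance instPDLattice (n : ℕ) : PDLattice (BPlus n) where
  compl := star
  le_compl_iff := le_star_iff

end BPlus

/-- The variety `𝓑ₙ`, generated by `2ⁿ ⊕ 1`. -/
noncomputable def varietyB (n : ℕ) : PDVariety := PDVariety.generatedBy (BPlus n)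

/-- `B` is congruence extensile in the variety `V`: it belongs to `V`, and for every `C` in `V`
containing `B` as a subalgebra (by means of an embedding `ι`), each congruence `Θ` of `B` is the
restriction to `B` of a congruence `Ψ` of `C`. -/
def CongruenceExtensile (V : PDVariety) (B : Type u) [PDLattice B] : Prop :=
  V.Mem B ∧
    ∀ (C : Type v) [PDLattice C], V.Mem C →
      ∀ ι : StarHom B C, Function.Injective ι →
        ∀ Θ : PDCongruence B, ∃ Ψ : PDCongruence C,
          ∀ x y : B, Ψ.r (ι x) (ι y) ↔ Θ.r x y

/-!
The algebra `I → BPlus n` lies in the variety because identities pass to powers. Its congruences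
extend because every pseudocomplemented distributive lattice has the congruence extension property
(Grätzer–Lakser), so nothing specific to `BPlus n` is needed for that half.

Let `ι : B → C` be an embedding and `Θ` a congruence of `B`. In a distributive lattice the
congruence collapsing `a ≤ b` relates `x` and `y` exactly when `x ⊓ a = y ⊓ a` and
`x ⊔ b = y ⊔ b`. The extension `Ψ` is the equivalence relation generated by all these relations
for `a = ι u`, `b = ι v` with `u ≤ v` and `u Θ v`, that is, the lattice congruence of `C` generated
by `Θ`. Two points need an argument.

* `Ψ` respects pseudocomplements (`PrincipalStep.compl`): if `x` and `y` are related through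
  `a ≤ b`, then `xᶜ` and `yᶜ` agree below `d = (aᶜ ⊓ b)ᶜ`. Since `aᶜ ⊓ b` is congruent to
  `aᶜ ⊓ a = ⊥`, the element `d` is congruent to `⊤`, so `xᶜ` and `yᶜ` are related through `d ≤ ⊤`.
* `Ψ` does not identify more elements of `B` than `Θ` does. The relation `CutRel` is a second,
  a priori larger, equivalence relation: a derivation of `CutRel x y` splits the pair at finitely
  many pairs `a, b` into equalities of lattice expressions. If `x` and `y` come from `B`, then so do
  all these expressions, the equalities hold already in `B`, and each splitting can be undone
  modulo `Θ` by distributivity (`CutRel.restrict`).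
-/

/-- The value of a term in a product is computed coordinatewise. -/
theorem PDTerm.eval_pi {I : Type u} {L : I → Type v} [∀ i, PDLattice (L i)]
    (a : ℕ → ∀ i, L i) (t : PDTerm) (i : I) : t.eval a i = t.eval fun k => a k i := by
  induction t with
  | var k => rfl
  | bot => rfl
  | top => rfl
  | sup s t hs ht => exact congrArg₂ (· ⊔ ·) hs ht
  | inf s t hs ht => exact congrArg₂ (· ⊓ ·) hs ht
  | star t ht => exact congrArg (·ᶜ) ht

theorem PDVariety.Mem.pi {V : PDVariety} {I : Type u} {L : I → Type v} [∀ i, PDLattice (L i)]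
    (h : ∀ i, V.Mem (L i)) : V.Mem (∀ i, L i) := by
  intro e he a
  funext i
  rw [PDTerm.eval_pi, PDTerm.eval_pi]
  exact h i e he _

theorem PDVariety.mem_generatedBy (A : Type u) [PDLattice A] : (generatedBy A).Mem A :=
  fun _ he => he

section CongruenceExtension

variable {B : Type u} {C : Type v} [PDLattice B] [PDLattice C]

namespace PDLattice

theorem compl_inf_self (x : B) : xᶜ ⊓ x = ⊥ :=
  (le_compl_iff xᶜ x).1 le_rfl

theorem compl_bot : (⊥ : B)ᶜ = ⊤ :=
  top_le_iff.1 ((le_compl_iff ⊤ ⊥).2 (inf_bot_eq ⊤))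

/-- If `x` and `y` are identified by the lattice congruence collapsing `a` and `b`, then `xᶜ ≤ yᶜ`
below `(aᶜ ⊓ b)ᶜ`. -/
theorem compl_inf_le_compl {a b x y : B} (ha : x ⊓ a = y ⊓ a) (hb : x ⊔ b = y ⊔ b) :
    xᶜ ⊓ (aᶜ ⊓ b)ᶜ ≤ yᶜ := by
  rw [le_compl_iff]
  set z := xᶜ ⊓ (aᶜ ⊓ b)ᶜ ⊓ y with hz
  have hzx : z ≤ xᶜ := inf_le_left.trans inf_le_left
  have hzy : z ≤ y := inf_le_right
  have hx : z ⊓ x = ⊥ := (le_compl_iff z x).1 hzx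
  have h1 : z ≤ aᶜ := by
    rw [le_compl_iff, ← le_bot_iff, ← hx]
    refine le_inf inf_le_left ?_
    calc z ⊓ a ≤ y ⊓ a := inf_le_inf_right a hzy
      _ = x ⊓ a := ha.symm
      _ ≤ x := inf_le_left
  have h2 : z ≤ b := by
    have h : z ≤ x ⊔ b := hb ▸ hzy.trans le_sup_left
    calc z = z ⊓ (x ⊔ b) := (inf_eq_left.2 h).symm
      _ = z ⊓ b := by rw [inf_sup_left, hx, bot_sup_eq]
      _ ≤ b := inf_le_right
  have h3 : z ≤ (aᶜ ⊓ b)ᶜ := inf_le_left.trans inf_le_right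
  rw [← (le_compl_iff z (aᶜ ⊓ b)).1 h3]
  exact (inf_eq_left.2 (le_inf h1 h2)).symm

theorem compl_inf_eq_compl_inf {a b x y : B} (ha : x ⊓ a = y ⊓ a) (hb : x ⊔ b = y ⊔ b) :
    xᶜ ⊓ (aᶜ ⊓ b)ᶜ = yᶜ ⊓ (aᶜ ⊓ b)ᶜ :=
  le_antisymm (le_inf (compl_inf_le_compl ha hb) inf_le_right)
    (le_inf (compl_inf_le_compl ha.symm hb.symm) inf_le_right)

end PDLattice

namespace StarHom

variable (f : StarHom B C)

theorem apply_sup (x y : B) : f (x ⊔ y) = f x ⊔ f y := f.map_sup' x y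
theorem apply_inf (x y : B) : f (x ⊓ y) = f x ⊓ f y := f.map_inf' x y
theorem apply_compl (x : B) : f xᶜ = (f x)ᶜ := f.map_compl' x
theorem apply_top : f ⊤ = ⊤ := f.map_top'

end StarHom

/-- Two elements that are congruent after meeting with `a` and after joining with `b`, where `a` and
`b` are themselves congruent, are congruent. -/
theorem PDCongruence.of_inf_of_sup (Θ : PDCongruence B) {a b x y : B} (hab : Θ.r a b)
    (h1 : Θ.r (x ⊓ a) (y ⊓ a)) (h2 : Θ.r (x ⊔ b) (y ⊔ b)) : Θ.r x y := by
  have refl := Θ.iseqv.refl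
  have trans {x y z : B} : Θ.r x y → Θ.r y z → Θ.r x z := Θ.iseqv.trans
  have symm {x y : B} : Θ.r x y → Θ.r y x := Θ.iseqv.symm
  have h3 : Θ.r (x ⊔ a) (y ⊔ a) :=
    trans (Θ.sup' (refl x) hab) (trans h2 (Θ.sup' (refl y) (symm hab)))
  have key : ∀ {x y : B}, Θ.r (x ⊓ a) (y ⊓ a) → Θ.r (x ⊔ a) (y ⊔ a) → Θ.r x (x ⊓ y) := by
    intro x y h1 h3
    have e1 := Θ.inf' (refl x) h3
    rw [inf_sup_self, inf_sup_left] at e1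
    have e2 := Θ.sup' (refl (x ⊓ y)) (Θ.inf' (refl x) h1)
    rw [← inf_assoc, inf_idem, ← inf_assoc, sup_inf_self] at e2
    exact trans e1 e2
  have h4 := key (symm h1) (symm h3)
  rw [inf_comm] at h4
  exact trans (key h1 h3) (symm h4)

/-- `x` and `y` are identified by the lattice congruence of `C` collapsing `ι u ≤ ι v`, for some
`u ≤ v` with `u Θ v`. -/
def PrincipalStep (ι : StarHom B C) (Θ : PDCongruence B) (x y : C) : Prop :=
  ∃ u v : B, u ≤ v ∧ Θ.r u v ∧ x ⊓ ι u = y ⊓ ι u ∧ x ⊔ ι v = y ⊔ ι v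

/-- The pairs of elements of `C` that become equal after finitely many splittings of `(x, y)` into
`(x ⊓ ι u, y ⊓ ι u)` and `(x ⊔ ι v, y ⊔ ι v)` with `u Θ v`. -/
inductive CutRel (ι : StarHom B C) (Θ : PDCongruence B) : C → C → Prop
  | refl (x : C) : CutRel ι Θ x x
  | cut {x y : C} (u v : B) (huv : Θ.r u v) (hinf : CutRel ι Θ (x ⊓ ι u) (y ⊓ ι u))
      (hsup : CutRel ι Θ (x ⊔ ι v) (y ⊔ ι v)) : CutRel ι Θ x y

variable {ι : StarHom B C} {Θ : PDCongruence B}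

namespace CutRel

theorem symm {x y : C} (h : CutRel ι Θ x y) : CutRel ι Θ y x := by
  induction h with
  | refl x => exact refl x
  | cut u v huv _ _ h1 h2 => exact cut u v huv h1 h2

theorem inf_right {x y : C} (h : CutRel ι Θ x y) (c : C) : CutRel ι Θ (x ⊓ c) (y ⊓ c) := by
  induction h generalizing c with
  | refl x => exact refl _
  | cut u v huv _ _ h1 h2 =>
    refine cut u v huv ?_ ?_
    · rw [inf_right_comm, inf_right_comm _ c]
      exact h1 c
    · rw [sup_inf_right, sup_inf_right]
      exact h2 _

theorem sup_right {x y : C} (h : CutRel ι Θ x y) (c : C) : CutRel ι Θ (x ⊔ c) (y ⊔ c) := by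
  induction h generalizing c with
  | refl x => exact refl _
  | cut u v huv _ _ h1 h2 =>
    refine cut u v huv ?_ ?_
    · rw [inf_sup_right, inf_sup_right]
      exact h1 _
    · rw [sup_right_comm, sup_right_comm _ c]
      exact h2 c

theorem trans {x y z : C} (h : CutRel ι Θ x y) (h' : CutRel ι Θ y z) : CutRel ι Θ x z := by
  induction h generalizing z with
  | refl x => exact h'
  | cut u v huv _ _ h1 h2 => exact cut u v huv (h1 (h'.inf_right _)) (h2 (h'.sup_right _))

/-- On the image of `B`, the relation `CutRel` is contained in `Θ`. -/
theorem restrict (hι : Function.Injective ι) {p q : B} (h : CutRel ι Θ (ι p) (ι q)) :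
    Θ.r p q := by
  generalize hx : ι p = x at h
  generalize hy : ι q = y at h
  induction h generalizing p q with
  | refl x => exact hι (hx.trans hy.symm) ▸ Θ.iseqv.refl p
  | cut u v huv _ _ h1 h2 =>
    subst hx hy
    exact Θ.of_inf_of_sup huv (h1 (ι.apply_inf p u) (ι.apply_inf q u))
      (h2 (ι.apply_sup p v) (ι.apply_sup q v))

end CutRel

namespace PrincipalStep

theorem inf_right {x y : C} (h : PrincipalStep ι Θ x y) (c : C) :
    PrincipalStep ι Θ (x ⊓ c) (y ⊓ c) := by
  obtain ⟨u, v, huv, hΘ, h1, h2⟩ := h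
  refine ⟨u, v, huv, hΘ, ?_, ?_⟩
  · rw [inf_right_comm, h1, inf_right_comm]
  · rw [sup_inf_right, h2, ← sup_inf_right]

theorem sup_right {x y : C} (h : PrincipalStep ι Θ x y) (c : C) :
    PrincipalStep ι Θ (x ⊔ c) (y ⊔ c) := by
  obtain ⟨u, v, huv, hΘ, h1, h2⟩ := h
  refine ⟨u, v, huv, hΘ, ?_, ?_⟩
  · rw [inf_sup_right, h1, ← inf_sup_right]
  · rw [sup_right_comm, h2, sup_right_comm]

/-- Elements identified by collapsing `u ≤ v` have pseudocomplements identified by collapsing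
`(uᶜ ⊓ v)ᶜ ≤ ⊤`. -/
theorem compl {x y : C} (h : PrincipalStep ι Θ x y) : PrincipalStep ι Θ xᶜ yᶜ := by
  obtain ⟨u, v, -, hΘ, h1, h2⟩ := h
  refine ⟨(uᶜ ⊓ v)ᶜ, ⊤, le_top, ?_, ?_, ?_⟩
  · have h := Θ.compl' (Θ.inf' (Θ.iseqv.refl uᶜ) (Θ.iseqv.symm hΘ))
    rwa [PDLattice.compl_inf_self, PDLattice.compl_bot] at h
  · rw [ι.apply_compl, ι.apply_inf, ι.apply_compl]
    exact PDLattice.compl_inf_eq_compl_inf h1 h2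
  · rw [ι.apply_top, sup_top_eq, sup_top_eq]

theorem of_congr {p q : B} (h : Θ.r p q) : PrincipalStep ι Θ (ι p) (ι q) := by
  refine ⟨p ⊓ q, p ⊔ q, inf_le_sup, ?_, ?_, ?_⟩
  · have h1 := Θ.inf' h (Θ.iseqv.refl q)
    have h2 := Θ.sup' (Θ.iseqv.symm h) (Θ.iseqv.refl q)
    rw [inf_idem] at h1
    rw [sup_idem] at h2
    exact Θ.iseqv.trans h1 h2
  · rw [ι.apply_inf, inf_eq_right.2 inf_le_left, inf_eq_right.2 inf_le_right]
  · rw [ι.apply_sup, sup_eq_right.2 le_sup_left, sup_eq_right.2 le_sup_right]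

theorem cutRel {x y : C} (h : PrincipalStep ι Θ x y) : CutRel ι Θ x y := by
  obtain ⟨u, v, -, hΘ, h1, h2⟩ := h
  exact .cut u v hΘ (h1 ▸ .refl _) (h2 ▸ .refl _)

end PrincipalStep

open Relation

theorem Relation.EqvGen.map_of_forall {α : Type*} {r : α → α → Prop} {g : α → α}
    (hg : ∀ x y, r x y → r (g x) (g y)) {x y : α} (h : EqvGen r x y) : EqvGen r (g x) (g y) := by
  induction h with
  | rel x y h => exact .rel _ _ (hg x y h)
  | refl x => exact .refl _
  | symm x y _ h => exact .symm _ _ h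
  | trans x y z _ _ h h' => exact .trans _ _ _ h h'

/-- The congruence of `C` generated by the image of `Θ` under `ι`. -/
def PDCongruence.extend (ι : StarHom B C) (Θ : PDCongruence B) : PDCongruence C where
  toSetoid := EqvGen.setoid (PrincipalStep ι Θ)
  sup' {a b c d} h h' := by
    refine .trans _ (b ⊔ c) _ (h.map_of_forall (g := (· ⊔ c)) fun _ _ h => h.sup_right c) ?_
    rw [sup_comm b c, sup_comm b d]
    exact h'.map_of_forall (g := (· ⊔ b)) fun _ _ h => h.sup_right b
  inf' {a b c d} h h' := by
    refine .trans _ (b ⊓ c) _ (h.map_of_forall (g := (· ⊓ c)) fun _ _ h => h.inf_right c) ?_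
    rw [inf_comm b c, inf_comm b d]
    exact h'.map_of_forall (g := (· ⊓ b)) fun _ _ h => h.inf_right b
  compl' h := h.map_of_forall (g := (·ᶜ)) fun _ _ h => h.compl

theorem PDCongruence.cutRel_of_extend {x y : C} (h : (Θ.extend ι).r x y) : CutRel ι Θ x y := by
  induction h with
  | rel x y h => exact h.cutRel
  | refl x => exact .refl x
  | symm x y _ h => exact h.symm
  | trans x y z _ _ h h' => exact h.trans h'

theorem PDCongruence.extend_apply_iff (hι : Function.Injective ι) (p q : B) :
    (Θ.extend ι).r (ι p) (ι q) ↔ Θ.r p q :=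
  ⟨fun h => (cutRel_of_extend h).restrict hι, fun h => .rel _ _ (.of_congr h)⟩

end CongruenceExtension

theorem mainTheorem5 (n : ℕ) (hn : 2 ≤ n) (I : Type u) :
    CongruenceExtensile.{u, v} (varietyB n) (I → BPlus n) :=
  ⟨PDVariety.Mem.pi fun _ => PDVariety.mem_generatedBy (BPlus n),
    fun _ _ _ ι hι Θ => ⟨Θ.extend ι, Θ.extend_apply_iff hι⟩⟩
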